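/- Let $A\in\mathbb C^{n\times n}$ and let $z_1,\dots,z_N\in\mathbb C$, $N\ge 1$, be arbitrary (possibly repeated) points. Let $f$ be analytic on an open set containing the convex hull of $\sigma(A)\cup\{z_1,\dots,z_N\}$, where $\sigma(A)$ is the spectrum of $A$. Let $u,v$ be complex polynomials with $\deg u\le N-1$, with $v(z_k)\ne0$ for $k=1,\dots,N$ and $v(\lambda)\neq0$ for all $\lambda\in\sigma(A)$, and suppose that the rational function $r=u/v$ interpolates $f$ at $z_1,\dots,z_N$ counted with multiplicities: $r^{(j)}(z_k)=f^{(j)}(z_k)$ for every $k$ and every $0\le j<n_k$, where $n_k$ is the number of indices $i$ with $z_i=z_k$. Put $\Omega(z)=\prod_{k=1}^N(z-z_k)$. For a function $g$ analytic on a neighbourhood of the spectrum of a square matrix $B$ let $g(B)=\frac1{2\pi i}\int_\Gamma g(\lambda)(\lambda\mathbf 1-B)^{-1}\,d\lambda$, where $\Gamma$ is a contour enclosing the spectrum of $B$, with $g$ analytic on and inside $\Gamma$. Then for every $b\in\mathbb C^n$, with $\lVert\cdot\rVert_2$ the Euclidean norm on $\mathbb C^n$, $$\bigl\lVert (f(A)-r(A))b\bigr\rVert_2\le\max_{\substack{t\in[0,1]\\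 \mu\in\operatorname{co}\{z_1,\dots,z_N\}}}\Bigl\lVert \Omega(A)\,[v(A)]^{-1}\,\frac{(vf)^{(N)}\bigl((1-t)\mu\mathbf 1+tA\bigr)}{N!}\,b\Bigr\rVert_2 ,$$ where $\operatorname{co}$ denotes the convex hull and the maximum on the right is attained. -/

import Mathlib

/-- The contour used to evaluate an analytic function `f` at the matrix `A` is the union of the
positively oriented circles of radius `ε` about the eigenvalues of `A`. The radius is admissible
when the closed discs are pairwise disjoint and `f` is analytic on all of them. -/
def IsAdmissibleRadius {n : ℕ} (f : ℂ → ℂ) (A : Matrix (Fin n) (Fin n) ℂ) (ε : ℝ) : Prop :=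
  0 < ε ∧ (∀ a ∈ spectrum ℂ A, AnalyticOnNhd ℂ f (Metric.closedBall a ε)) ∧
    ∀ a ∈ spectrum ℂ A, ∀ c ∈ spectrum ℂ A, a ≠ c →
      Disjoint (Metric.closedBall a ε) (Metric.closedBall c ε)

/-- The Cauchy integral `(2πi)⁻¹ ∫_Γ f(z) (z 1 - A)⁻¹ dz`, computed entrywise, where `Γ` is the
union of the circles of radius `ε` about the eigenvalues of `A`. -/
noncomputable def matrixCauchyIntegral {n : ℕ} (f : ℂ → ℂ) (A : Matrix (Fin n) (Fin n) ℂ)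
    (ε : ℝ) : Matrix (Fin n) (Fin n) ℂ :=
  Matrix.of fun i j => (2 * (Real.pi : ℂ) * Complex.I)⁻¹ *
    ∑ a ∈ A.finite_spectrum.toFinset,
      ∮ z in C(a, ε), f z * ((z • (1 : Matrix (Fin n) (Fin n) ℂ) - A)⁻¹ i j)

open Classical in
/-- The analytic function `f` applied to the matrix `A`: the Cauchy integral over a contour that
encloses the spectrum of `A`. An admissible radius exists as soon as `f` is analytic on a
neighbourhood of the spectrum, and the value does not depend on it (see the two lemmas below). -/
noncomputable def matrixFun {n : ℕ} (f : ℂ → ℂ) (A : Matrix (Fin n) (Fin n) ℂ) :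
    Matrix (Fin n) (Fin n) ℂ :=
  if h : ∃ ε, IsAdmissibleRadius f A ε then matrixCauchyIntegral f A h.choose else 0

theorem exists_isAdmissibleRadius {n : ℕ} {f : ℂ → ℂ} {A : Matrix (Fin n) (Fin n) ℂ}
    (hf : ∀ a ∈ spectrum ℂ A, AnalyticAt ℂ f a) : ∃ ε, IsAdmissibleRadius f A ε := by
  have hfin : (spectrum ℂ A).Finite := A.finite_spectrum
  have h1 : ∀ a ∈ spectrum ℂ A, ∀ᶠ ε in nhdsWithin (0 : ℝ) (Set.Ioi 0),
      AnalyticOnNhd ℂ f (Metric.closedBall a ε) := by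
    intro a ha
    obtain ⟨r, hr, h⟩ := Metric.eventually_nhds_iff.1 (hf a ha).eventually_analyticAt
    filter_upwards [nhdsWithin_le_nhds (Iio_mem_nhds hr)] with ε hε z hz
    exact h (lt_of_le_of_lt hz hε)
  have h2 : ∀ a ∈ spectrum ℂ A, ∀ c ∈ spectrum ℂ A, ∀ᶠ ε in nhdsWithin (0 : ℝ) (Set.Ioi 0),
      a ≠ c → Disjoint (Metric.closedBall a ε) (Metric.closedBall c ε) := by
    intro a _ c _
    by_cases hac : a = c
    · exact Filter.Eventually.of_forall fun _ h => absurd hac h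
    · have : 0 < dist a c / 2 := half_pos (dist_pos.2 hac)
      filter_upwards [nhdsWithin_le_nhds (Iio_mem_nhds this)] with ε hε _
      have hε' : ε < dist a c / 2 := hε
      exact Metric.closedBall_disjoint_closedBall (by linarith)
  have h3 : ∀ᶠ ε in nhdsWithin (0 : ℝ) (Set.Ioi 0), IsAdmissibleRadius f A ε := by
    filter_upwards [self_mem_nhdsWithin, (Filter.eventually_all_finite hfin).2 h1,
      (Filter.eventually_all_finite hfin).2 fun a ha =>
        (Filter.eventually_all_finite hfin).2 (h2 a ha)] with ε h4 h5 h6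
    exact ⟨h4, h5, h6⟩
  exact h3.exists

theorem differentiableAt_resolvent_entry {n : ℕ} {A : Matrix (Fin n) (Fin n) ℂ} {w : ℂ}
    (hw : w ∉ spectrum ℂ A) (i j : Fin n) :
    DifferentiableAt ℂ (fun z : ℂ => (z • (1 : Matrix (Fin n) (Fin n) ℂ) - A)⁻¹ i j) w := by
  have hdet : (w • (1 : Matrix (Fin n) (Fin n) ℂ) - A).det ≠ 0 := by
    rw [spectrum.notMem_iff, Algebra.algebraMap_eq_smul_one, Matrix.isUnit_iff_isUnit_det] at hw
    exact hw.ne_zero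
  have hentry : ∀ k l : Fin n, Differentiable ℂ
      (fun z : ℂ => (z • (1 : Matrix (Fin n) (Fin n) ℂ) - A) k l) := by
    intro k l
    simp only [Matrix.sub_apply, Matrix.smul_apply, smul_eq_mul]
    fun_prop
  have hd : ∀ M : ℂ → Matrix (Fin n) (Fin n) ℂ, (∀ k l, Differentiable ℂ fun z => M z k l) →
      Differentiable ℂ fun z => (M z).det := by
    intro M hM
    simp only [Matrix.det_apply']
    fun_prop
  simp only [Matrix.inv_def, Matrix.smul_apply, Ring.inverse_eq_inv', smul_eq_mul,
    Matrix.adjugate_apply]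
  refine ((hd _ hentry w).inv hdet).mul (hd _ ?_ w)
  intro k l
  simp only [Matrix.updateRow_apply]
  split_ifs
  · fun_prop
  · exact hentry k l

theorem matrixCauchyIntegral_eq_of_le {n : ℕ} {f : ℂ → ℂ} {A : Matrix (Fin n) (Fin n) ℂ}
    {δ ε : ℝ} (hδ : 0 < δ) (hle : δ ≤ ε) (h : IsAdmissibleRadius f A ε) :
    matrixCauchyIntegral f A ε = matrixCauchyIntegral f A δ := by
  ext i j
  simp only [matrixCauchyIntegral, Matrix.of_apply]
  congr 1
  refine Finset.sum_congr rfl fun a ha => ?_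
  rw [Set.Finite.mem_toFinset] at ha
  have key : ∀ z ∈ Metric.closedBall a ε \ Metric.ball a δ, DifferentiableAt ℂ
      (fun z => f z * ((z • (1 : Matrix (Fin n) (Fin n) ℂ) - A)⁻¹ i j)) z := by
    intro z hz
    refine ((h.2.1 a ha) z hz.1).differentiableAt.mul (differentiableAt_resolvent_entry ?_ i j)
    intro hzs
    by_cases hza : a = z
    · exact hz.2 (hza ▸ Metric.mem_ball_self hδ)
    · exact Set.disjoint_left.1 (h.2.2 a ha z hzs hza) hz.1
        (Metric.mem_closedBall_self h.1.le)
  refine Complex.circleIntegral_eq_of_differentiable_on_annulus_off_countable hδ hle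
    Set.countable_empty (fun z hz => (key z hz).continuousAt.continuousWithinAt) ?_
  rintro z ⟨⟨hz1, hz2⟩, -⟩
  exact key z ⟨Metric.ball_subset_closedBall hz1,
    fun hz => hz2 (Metric.ball_subset_closedBall hz)⟩

/-- The value of `matrixFun f A` is the Cauchy integral for every admissible radius. -/
theorem matrixFun_eq {n : ℕ} {f : ℂ → ℂ} {A : Matrix (Fin n) (Fin n) ℂ} {ε : ℝ}
    (h : IsAdmissibleRadius f A ε) : matrixFun f A = matrixCauchyIntegral f A ε := by
  have hex : ∃ ε, IsAdmissibleRadius f A ε := ⟨ε, h⟩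
  rw [matrixFun, dif_pos hex]
  rcases le_total hex.choose ε with hle | hle
  · exact (matrixCauchyIntegral_eq_of_le hex.choose_spec.1 hle h).symm
  · exact matrixCauchyIntegral_eq_of_le h.1 hle hex.choose_spec

/-- The rational function `u / v` satisfies the Hermite interpolation conditions for `f` at the
points `z 0, …, z (N - 1)`, the multiplicity of a point being the number of its repetitions in
the list. -/
def Interpolates {N : ℕ} (u v : Polynomial ℂ) (f : ℂ → ℂ) (z : Fin N → ℂ) : Prop :=
  ∀ k : Fin N, ∀ j : ℕ, j < (Finset.univ.filter fun i => z i = z k).card →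
    iteratedDeriv j (fun w => u.eval w / v.eval w) (z k) = iteratedDeriv j f (z k)

/-- The nodal polynomial `Ω(w) = ∏ (w - z k)`. -/
noncomputable def nodalPoly {N : ℕ} (z : Fin N → ℂ) : Polynomial ℂ :=
  ∏ k, (Polynomial.X - Polynomial.C (z k))

/-- The Euclidean norm of a vector in `ℂⁿ`. -/
noncomputable def euclNorm {n : ℕ} (x : Fin n → ℂ) : ℝ :=
  ‖(WithLp.toLp 2 x : EuclideanSpace ℂ (Fin n))‖

/-! With `g = (vf)[z₁, …, z_N, ·]`, Newton's remainder formula gives `vf - u = Ω g`, hence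
`v(A) (f(A) - r(A)) = Ω(A) g(A)`. The Hermite–Genocchi bound of `g(A)` by the values of
`(vf)⁽ᴺ⁾((1 - t) μ 1 + t A) / N!` is obtained node by node and without integrals: from
`d/dt [t ^ (k + 1) (dslope h a)⁽ᵏ⁾((1 - t) a + t x)] = t ^ k h⁽ᵏ⁺¹⁾((1 - t) a + t x)`
and the mean value inequality. This scalar identity passes to matrices `x = A` because a spectral
decomposition writes an analytic function of `A` as a finite combination of its derivatives at the
eigenvalues.
-/

open Set Filter Topology

section DividedDifferences

variable {𝕜 E : Type*} [NontriviallyNormedField 𝕜] [NormedAddCommGroup E] [NormedSpace 𝕜 E]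

theorem analyticAt_dslope {h : 𝕜 → E} {a x : 𝕜} (ha : AnalyticAt 𝕜 h a) (hx : AnalyticAt 𝕜 h x) :
    AnalyticAt 𝕜 (dslope h a) x := by
  obtain rfl | hne := eq_or_ne x a
  · obtain ⟨p, hp⟩ := ha
    exact ⟨_, hp.has_fpower_series_dslope_fslope⟩
  · have hslope : AnalyticAt 𝕜 (fun w => (w - a)⁻¹ • (h w - h a)) x :=
      ((analyticAt_id.sub analyticAt_const).inv (sub_ne_zero.2 hne)).smul (hx.sub analyticAt_const)
    exact hslope.congr (dslope_eventuallyEq_slope_of_ne h hne).symm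

theorem iteratedDeriv_iteratedDeriv (k m : ℕ) (h : 𝕜 → E) :
    iteratedDeriv k (iteratedDeriv m h) = iteratedDeriv (m + k) h := by
  rw [iteratedDeriv_eq_iterate, iteratedDeriv_eq_iterate, iteratedDeriv_eq_iterate, add_comm,
    Function.iterate_add_apply]

theorem analyticAt_iteratedDeriv [CompleteSpace E] {h : 𝕜 → E} {x : 𝕜} (hh : AnalyticAt 𝕜 h x)
    (k : ℕ) : AnalyticAt 𝕜 (iteratedDeriv k h) x := by
  rw [iteratedDeriv_eq_iterate]
  exact hh.iterated_deriv k

theorem hasDerivAt_iteratedDeriv [CompleteSpace E] {h : 𝕜 → E} {x : 𝕜} (hh : AnalyticAt 𝕜 h x)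
    (k : ℕ) : HasDerivAt (iteratedDeriv k h) (iteratedDeriv (k + 1) h x) x := by
  rw [iteratedDeriv_succ, hasDerivAt_deriv_iff]
  exact (analyticAt_iteratedDeriv hh k).differentiableAt

theorem iteratedDeriv_succ_sub_smul [CompleteSpace E] {d : 𝕜 → E} {a x : 𝕜}
    (hd : AnalyticAt 𝕜 d x) (k : ℕ) :
    iteratedDeriv (k + 1) (fun w => (w - a) • d w) x =
      (x - a) • iteratedDeriv (k + 1) d x + (k + 1 : 𝕜) • iteratedDeriv k d x := by
  induction k generalizing x with
  | zero =>
    rw [iteratedDeriv_one]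
    simpa using (((hasDerivAt_id x).sub_const a).fun_smul hd.differentiableAt.hasDerivAt).deriv
  | succ k ih =>
    have hleibniz : iteratedDeriv (k + 1) (fun w => (w - a) • d w) =ᶠ[𝓝 x] fun y =>
        (y - a) • iteratedDeriv (k + 1) d y + (k + 1 : 𝕜) • iteratedDeriv k d y :=
      hd.eventually_analyticAt.mono fun y hy => ih hy
    have hderiv := (((hasDerivAt_id x).sub_const a).smul (hasDerivAt_iteratedDeriv hd (k + 1))).add
      ((hasDerivAt_iteratedDeriv hd k).const_smul (k + 1 : 𝕜))
    rw [iteratedDeriv_succ, hleibniz.deriv_eq]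
    refine hderiv.deriv.trans ?_
    push_cast
    simp only [id]
    module

theorem iteratedDeriv_succ_eq_dslope [CompleteSpace E] {h : 𝕜 → E} {a x : 𝕜}
    (ha : AnalyticAt 𝕜 h a) (hx : AnalyticAt 𝕜 h x) (k : ℕ) :
    iteratedDeriv (k + 1) h x = (x - a) • iteratedDeriv (k + 1) (dslope h a) x +
      (k + 1 : 𝕜) • iteratedDeriv k (dslope h a) x := by
  have hfactor : h = fun w => h a + (w - a) • dslope h a w := by
    ext w
    rw [sub_smul_dslope, add_sub_cancel]
  conv_lhs => rw [hfactor]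
  rw [iteratedDeriv_const_add k.succ_pos, iteratedDeriv_succ_sub_smul (analyticAt_dslope ha hx)]

theorem hasDerivAt_pow_smul_iteratedDeriv_dslope [CompleteSpace E] {h : 𝕜 → E} {a x t : 𝕜}
    (ha : AnalyticAt 𝕜 h a) (hx : AnalyticAt 𝕜 h ((1 - t) * a + t * x)) (k : ℕ) :
    HasDerivAt (fun r => r ^ (k + 1) • iteratedDeriv k (dslope h a) ((1 - r) * a + r * x))
      (t ^ k • iteratedDeriv (k + 1) h ((1 - t) * a + t * x)) t := by
  have hline : HasDerivAt (fun r => (1 - r) * a + r * x) (x - a) t := by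
    convert! (((hasDerivAt_id t).const_sub 1).mul_const a).add ((hasDerivAt_id t).mul_const x)
      using 1
    ring
  refine ((hasDerivAt_pow (k + 1) t).smul ((hasDerivAt_iteratedDeriv
    (analyticAt_dslope ha hx) k).scomp t hline)).congr_deriv ?_
  rw [iteratedDeriv_succ_eq_dslope ha hx, Nat.add_sub_cancel, Function.comp_apply]
  push_cast
  module

/-- The iterated divided difference `w ↦ h[a₁, …, a_N, w]` of `h` at the points of the list
`[a₁, …, a_N]`, as a function of its last node; repeated nodes are covered by `dslope`. -/
noncomputable def dividedDiff (l : List 𝕜) (h : 𝕜 → E) : 𝕜 → E :=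
  l.foldl dslope h

@[simp]
theorem dividedDiff_nil (h : 𝕜 → E) : dividedDiff [] h = h :=
  rfl

@[simp]
theorem dividedDiff_cons (a : 𝕜) (l : List 𝕜) (h : 𝕜 → E) :
    dividedDiff (a :: l) h = dividedDiff l (dslope h a) :=
  rfl

theorem analyticAt_dividedDiff {l : List 𝕜} {h : 𝕜 → E} {x : 𝕜}
    (hl : ∀ a ∈ l, AnalyticAt 𝕜 h a) (hx : AnalyticAt 𝕜 h x) :
    AnalyticAt 𝕜 (dividedDiff l h) x := by
  induction l generalizing h with
  | nil => exact hx
  | cons a l ih =>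
    have ha := hl a List.mem_cons_self
    exact ih (fun b hb => analyticAt_dslope ha (hl b (List.mem_cons_of_mem a hb)))
      (analyticAt_dslope ha hx)

theorem dslope_sub {g h : 𝕜 → E} {a : 𝕜} (hg : DifferentiableAt 𝕜 g a)
    (hh : DifferentiableAt 𝕜 h a) : dslope (g - h) a = dslope g a - dslope h a := by
  ext w
  obtain rfl | hne := eq_or_ne w a
  · simp [deriv_sub hg hh]
  · simp only [Pi.sub_apply, dslope_of_ne _ hne, slope_def_module]
    module

theorem dividedDiff_sub {l : List 𝕜} {g h : 𝕜 → E} (hg : ∀ a ∈ l, AnalyticAt 𝕜 g a)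
    (hh : ∀ a ∈ l, AnalyticAt 𝕜 h a) :
    dividedDiff l (g - h) = dividedDiff l g - dividedDiff l h := by
  induction l generalizing g h with
  | nil => rfl
  | cons a l ih =>
    have ha := List.mem_cons_self (a := a) (l := l)
    simp only [dividedDiff_cons]
    rw [dslope_sub (hg a ha).differentiableAt (hh a ha).differentiableAt,
      ih (fun b hb => analyticAt_dslope (hg a ha) (hg b (List.mem_cons_of_mem a hb)))
        fun b hb => analyticAt_dslope (hh a ha) (hh b (List.mem_cons_of_mem a hb))]

theorem dslope_polynomial_eval (p : Polynomial 𝕜) (a : 𝕜) :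
    dslope (fun w => p.eval w) a = fun w => (p /ₘ (Polynomial.X - Polynomial.C a)).eval w := by
  ext w
  obtain rfl | hne := eq_or_ne w a
  · have := congrArg (Polynomial.eval w)
      (Polynomial.divByMonic_add_X_sub_C_mul_derivative_divByMonic_eq_derivative p w)
    simpa [Polynomial.deriv] using this.symm
  · have hdiv := congrArg (Polynomial.eval w)
      (Polynomial.X_sub_C_mul_divByMonic_eq_sub_modByMonic p a)
    rw [dslope_of_ne _ hne, slope_def_field, div_eq_iff (sub_ne_zero.2 hne)]
    simpa [Polynomial.modByMonic_X_sub_C_eq_C_eval, mul_comm] using hdiv.symm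

theorem dividedDiff_polynomial_eval_eq_zero {l : List 𝕜} {p : Polynomial 𝕜}
    (hp : p.degree < l.length) : dividedDiff l (fun w => p.eval w) = 0 := by
  induction l generalizing p with
  | nil =>
    have : p = 0 := Polynomial.degree_eq_bot.1 (by simpa [Nat.WithBot.lt_zero_iff] using hp)
    simp [this, Pi.zero_def]
  | cons a l ih =>
    rw [dividedDiff_cons, dslope_polynomial_eval]
    obtain rfl | hp0 := eq_or_ne p 0
    · exact ih (by simp)
    · refine ih ((Polynomial.degree_divByMonic_lt p (Polynomial.X - Polynomial.C a) hp0
        (by simp)).trans_le ?_)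
      rw [Polynomial.degree_eq_natDegree hp0] at hp ⊢
      exact_mod_cast Nat.le_of_lt_succ (by exact_mod_cast hp)

theorem analyticOrderAt_eq_add_dslope {h : 𝕜 → E} {a x : 𝕜} (ha : AnalyticAt 𝕜 h a)
    (hx : AnalyticAt 𝕜 h x) (hzero : h a = 0) :
    analyticOrderAt h x = analyticOrderAt (· - a) x + analyticOrderAt (dslope h a) x := by
  rw [← analyticOrderAt_smul (by fun_prop) (analyticAt_dslope ha hx)]
  congr 1
  ext w
  exact (sub_smul_dslope_of_zero hzero w).symm

theorem eq_prod_smul_dividedDiff [DecidableEq 𝕜] {l : List 𝕜} {h : 𝕜 → E}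
    (hh : ∀ a ∈ l, AnalyticAt 𝕜 h a)
    (hord : ∀ a ∈ l, (l.count a : ℕ∞) ≤ analyticOrderAt h a) (w : 𝕜) :
    h w = (l.map (w - ·)).prod • dividedDiff l h w := by
  induction l generalizing h with
  | nil => simp
  | cons a l ih =>
    have ha := hh a List.mem_cons_self
    have hl : ∀ b ∈ l, AnalyticAt 𝕜 h b := fun b hb => hh b (List.mem_cons_of_mem a hb)
    have hzero : h a = 0 := apply_eq_zero_of_analyticOrderAt_ne_zero fun h0 => by
      simpa [h0] using hord a List.mem_cons_self
    have hord_dslope : ∀ b ∈ l, (l.count b : ℕ∞) ≤ analyticOrderAt (dslope h a) b := by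
      intro b hb
      have hle := hord b (List.mem_cons_of_mem a hb)
      rw [analyticOrderAt_eq_add_dslope ha (hl b hb) hzero] at hle
      obtain rfl | hne := eq_or_ne b a
      · rw [List.count_cons_self, analyticOrderAt_id_sub_const_self, add_comm] at hle
        exact (ENat.add_le_add_iff_left ENat.one_ne_top).1 (by simpa using hle)
      · rwa [List.count_cons_of_ne hne.symm, analyticOrderAt_id_sub_const_of_ne hne,
          zero_add] at hle
    rw [← sub_smul_dslope_of_zero hzero w,
      ih (fun b hb => analyticAt_dslope ha (hl b hb)) hord_dslope, smul_smul]
    rfl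

theorem sub_polynomial_eval_eq_prod_mul_dividedDiff [DecidableEq 𝕜] {l : List 𝕜} {h : 𝕜 → 𝕜}
    {p : Polynomial 𝕜} (hp : p.degree < l.length) (hh : ∀ a ∈ l, AnalyticAt 𝕜 h a)
    (hord : ∀ a ∈ l, (l.count a : ℕ∞) ≤ analyticOrderAt (h - fun w => p.eval w) a) (w : 𝕜) :
    h w - p.eval w = (l.map (w - ·)).prod * dividedDiff l h w := by
  have hpoly : ∀ a ∈ l, AnalyticAt 𝕜 (fun w => p.eval w) a := fun a _ =>
    AnalyticOnNhd.eval_polynomial p a (mem_univ a)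
  have hremainder := eq_prod_smul_dividedDiff (fun a ha => (hh a ha).sub (hpoly a ha)) hord w
  rwa [dividedDiff_sub hh hpoly, dividedDiff_polynomial_eval_eq_zero hp, sub_zero] at hremainder

end DividedDifferences

section SpectralDecomposition

variable {K R ι : Type*} [Field K] [Ring R] [Algebra K R]

/-- Generalized spectral projections of `b`: the `q i` add up to `1` and `q i` is annihilated by
`(b - e i) ^ m`. The `e i` run through the spectrum of `b`, possibly with repetitions, so that the
notion is stable under affine maps, constant ones included. -/
structure IsSpectralDecomposition [Fintype ι] (b : R) (e : ι → K) (q : ι → R) (m : ℕ) :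
    Prop where
  sum_eq_one : ∑ i, q i = 1
  pow_mul_eq_zero (i : ι) : (b - algebraMap K R (e i)) ^ m * q i = 0
  mem_spectrum (i : ι) : e i ∈ spectrum K b

theorem algebraMap_sub_mul_sum_inv_pow_smul {c : K} (hc : c ≠ 0) (x q : R) (m : ℕ) :
    (algebraMap K R c - x) * ∑ k ∈ Finset.range m, (c ^ (k + 1))⁻¹ • (x ^ k * q) =
      q - (c ^ m)⁻¹ • (x ^ m * q) := by
  induction m with
  | zero => simp
  | succ m ih =>
    have hcancel : c * (c ^ (m + 1))⁻¹ = (c ^ m)⁻¹ := by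
      field_simp
      exact (pow_succ' c m).symm
    rw [Finset.sum_range_succ, mul_add, ih, mul_smul_comm, sub_mul, ← Algebra.smul_def, ← mul_assoc,
      ← pow_succ', smul_sub, smul_smul, mul_comm _ c, hcancel]
    abel

theorem affine_sub_algebraMap (s t c : K) (b : R) :
    s • 1 + t • b - algebraMap K R (s + t * c) = t • (b - algebraMap K R c) := by
  simp only [Algebra.algebraMap_eq_smul_one]
  module

theorem affine_mem_spectrum [IsDedekindFiniteMonoid R] {b : R} {c : K} (hc : c ∈ spectrum K b)
    (s t : K) : s + t * c ∈ spectrum K (s • 1 + t • b) := by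
  refine fun hunit => hc ?_
  rw [spectrum.mem_resolventSet_iff, ← neg_sub, affine_sub_algebraMap] at hunit
  rw [spectrum.mem_resolventSet_iff, ← neg_sub, IsUnit.neg_iff]
  obtain ⟨y, hy⟩ := ((IsUnit.neg_iff _).1 hunit).exists_right_inv
  exact IsUnit.of_mul_eq_one (t • y) (by rw [mul_smul_comm, ← smul_mul_assoc, hy])

namespace IsSpectralDecomposition

variable [Fintype ι] {b : R} {e : ι → K} {q : ι → R} {m : ℕ}

theorem algebraMap_sub_mul_sum_eq_one (D : IsSpectralDecomposition b e q m) {z : K}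
    (hz : ∀ i, z ≠ e i) :
    (algebraMap K R z - b) * ∑ i, ∑ k ∈ Finset.range m,
      ((z - e i) ^ (k + 1))⁻¹ • ((b - algebraMap K R (e i)) ^ k * q i) = 1 := by
  rw [Finset.mul_sum, ← D.sum_eq_one]
  refine Finset.sum_congr rfl fun i _ => ?_
  have hshift : algebraMap K R z - b =
      algebraMap K R (z - e i) - (b - algebraMap K R (e i)) := by
    rw [map_sub]
    abel
  rw [hshift, algebraMap_sub_mul_sum_inv_pow_smul (sub_ne_zero.2 (hz i)), D.pow_mul_eq_zero,
    smul_zero, sub_zero]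

theorem exists_eq_of_mem_spectrum [IsDedekindFiniteMonoid R] (D : IsSpectralDecomposition b e q m)
    {z : K} (hz : z ∈ spectrum K b) : ∃ i, z = e i := by
  by_contra! hne
  exact hz (IsUnit.of_mul_eq_one _ (D.algebraMap_sub_mul_sum_eq_one hne))

theorem affine [IsDedekindFiniteMonoid R] (D : IsSpectralDecomposition b e q m) (s t : K) :
    IsSpectralDecomposition (s • 1 + t • b) (fun i => s + t * e i) q m where
  sum_eq_one := D.sum_eq_one
  pow_mul_eq_zero i := by
    rw [affine_sub_algebraMap, smul_pow, smul_mul_assoc, D.pow_mul_eq_zero, smul_zero]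
  mem_spectrum i := affine_mem_spectrum (D.mem_spectrum i) s t

end IsSpectralDecomposition

/-- Bézout coefficients for the coprime powers `(X - a) ^ m` evaluate to the projections. -/
theorem exists_isSpectralDecomposition_of_aeval_prod_eq_zero {b : R} {S : Finset K} {m : ℕ}
    (hS : ∀ a ∈ S, a ∈ spectrum K b)
    (hzero : Polynomial.aeval b (∏ a : S, (Polynomial.X - Polynomial.C (a : K)) ^ m) = 0) :
    ∃ q, IsSpectralDecomposition b ((↑) : S → K) q m := by
  classical
  obtain hempty | hnonempty := isEmpty_or_nonempty S
  · exact ⟨0, by simpa using hzero.symm, isEmptyElim, isEmptyElim⟩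
  have hcoprime : Pairwise (Function.onFun IsCoprime
      fun a : S => (Polynomial.X - Polynomial.C (a : K)) ^ m) := fun a c hac =>
    (Polynomial.isCoprime_X_sub_C_of_isUnit_sub
      (sub_ne_zero.2 (Subtype.coe_ne_coe.2 hac)).isUnit).pow
  obtain ⟨μ, hμ⟩ := exists_sum_eq_one_iff_pairwise_coprime'.2 hcoprime
  refine ⟨fun a => Polynomial.aeval b
    (μ a * ∏ c ∈ {a}ᶜ, (Polynomial.X - Polynomial.C (c : K)) ^ m), ?_, fun a => ?_,
    fun a => hS a a.2⟩
  · rw [← map_sum, hμ, map_one]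
  · have hfactor : (b - algebraMap K R a) ^ m =
        Polynomial.aeval b ((Polynomial.X - Polynomial.C (a : K)) ^ m) := by simp
    rw [hfactor, ← map_mul, mul_left_comm, mul_comm (_ ^ m), ← Fintype.prod_eq_prod_compl_mul,
      map_mul, hzero, mul_zero]

theorem exists_isSpectralDecomposition {n : Type*} [Fintype n] [DecidableEq n] [IsAlgClosed K]
    (A : Matrix n n K) : ∃ (S : Finset K) (m : ℕ) (q : S → Matrix n n K),
      IsSpectralDecomposition A ((↑) : S → K) q m := by
  classical
  have hcharpoly : A.charpoly ∣ ∏ a : A.charpoly.roots.toFinset,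
      (Polynomial.X - Polynomial.C (a : K)) ^ Multiset.card A.charpoly.roots := by
    rw [Finset.prod_coe_sort A.charpoly.roots.toFinset
      fun a => (Polynomial.X - Polynomial.C a) ^ Multiset.card A.charpoly.roots]
    conv_lhs => rw [(IsAlgClosed.splits A.charpoly).eq_prod_roots_of_monic A.charpoly_monic,
      Finset.prod_multiset_map_count]
    exact Finset.prod_dvd_prod_of_dvd _ _ fun a _ => pow_dvd_pow _ (Multiset.count_le_card _ _)
  refine ⟨A.charpoly.roots.toFinset, Multiset.card A.charpoly.roots,
    exists_isSpectralDecomposition_of_aeval_prod_eq_zero (fun a ha => ?_) ?_⟩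
  · rw [Matrix.mem_spectrum_iff_isRoot_charpoly]
    exact Polynomial.isRoot_of_mem_roots (Multiset.mem_toFinset.1 ha)
  · obtain ⟨p, hp⟩ := hcharpoly
    rw [hp, map_mul, Matrix.aeval_self_charpoly, zero_mul]

theorem exists_eq_of_mem_spectrum_affine {n : Type*} [Fintype n] [DecidableEq n] [IsAlgClosed K]
    {A : Matrix n n K} {s t w : K} (hw : w ∈ spectrum K (s • 1 + t • A)) :
    ∃ a ∈ spectrum K A, w = s + t * a := by
  obtain ⟨S, m, q, D⟩ := exists_isSpectralDecomposition A
  obtain ⟨i, hi⟩ := (D.affine s t).exists_eq_of_mem_spectrum hw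
  exact ⟨i, D.mem_spectrum i, hi⟩

end SpectralDecomposition

section FunctionalCalculus

variable {n : ℕ} {A B : Matrix (Fin n) (Fin n) ℂ} {f g : ℂ → ℂ}

namespace IsAdmissibleRadius

variable {ε : ℝ} {a w z : ℂ}

theorem ne_of_mem_closedBall (h : IsAdmissibleRadius g A ε) (ha : a ∈ spectrum ℂ A)
    (hw : w ∈ spectrum ℂ A) (haw : a ≠ w) (hz : z ∈ Metric.closedBall a ε) : z ≠ w :=
  (h.2.2 a ha w hw haw).ne_of_mem hz (Metric.mem_closedBall_self h.1.le)

theorem ne_of_mem_sphere (h : IsAdmissibleRadius g A ε) (ha : a ∈ spectrum ℂ A)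
    (hw : w ∈ spectrum ℂ A) (hz : z ∈ Metric.sphere a ε) : z ≠ w := by
  obtain rfl | haw := eq_or_ne a w
  · exact Metric.ne_of_mem_sphere hz h.1.ne'
  · exact h.ne_of_mem_closedBall ha hw haw (Metric.sphere_subset_closedBall hz)

theorem circleIntegrable_div_sub_pow (h : IsAdmissibleRadius g A ε) (ha : a ∈ spectrum ℂ A)
    (hw : w ∈ spectrum ℂ A) (k : ℕ) : CircleIntegrable (fun z => g z / (z - w) ^ k) a ε :=
  ContinuousOn.circleIntegrable h.1.le <| ContinuousOn.div
    ((h.2.1 a ha).continuousOn.mono Metric.sphere_subset_closedBall) (by fun_prop)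
    fun _ hz => pow_ne_zero k (sub_ne_zero.2 (h.ne_of_mem_sphere ha hw hz))

theorem sum_circleIntegral_div_sub_pow (h : IsAdmissibleRadius g A ε) (hw : w ∈ spectrum ℂ A)
    (k : ℕ) :
    ∑ a ∈ A.finite_spectrum.toFinset, ∮ z in C(a, ε), g z / (z - w) ^ (k + 1) =
      2 * Real.pi * Complex.I * ((k.factorial : ℂ)⁻¹ * iteratedDeriv k g w) := by
  rw [Finset.sum_eq_single_of_mem w ((Set.Finite.mem_toFinset _).2 hw) fun a ha haw => ?_]
  · have hcauchy := (h.2.1 w hw).differentiableOn.circleIntegral_one_div_sub_center_pow_smul h.1 k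
    simp only [smul_eq_mul, div_mul_eq_mul_div, one_mul] at hcauchy
    rw [hcauchy, inv_mul_eq_div, mul_div_assoc']
  · have ha' := (Set.Finite.mem_toFinset _).1 ha
    refine DiffContOnCl.circleIntegral_eq_zero h.1.le (DifferentiableOn.diffContOnCl ?_)
    rw [closure_ball _ h.1.ne']
    exact (h.2.1 a ha').differentiableOn.div (by fun_prop) fun z hz =>
      pow_ne_zero _ (sub_ne_zero.2 (h.ne_of_mem_closedBall ha' hw haw hz))

end IsAdmissibleRadius

/-- The coefficient of the derivative `g⁽ᵏ⁾(c)` in `g(B)`, where `q` is the spectral projection of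
`B` belonging to the eigenvalue `c`. -/
noncomputable def jetCoeff (B : Matrix (Fin n) (Fin n) ℂ) (c : ℂ) (q : Matrix (Fin n) (Fin n) ℂ)
    (k : ℕ) : Matrix (Fin n) (Fin n) ℂ :=
  (k.factorial : ℂ)⁻¹ • ((B - algebraMap ℂ _ c) ^ k * q)

namespace IsSpectralDecomposition

variable {ι : Type*} [Fintype ι] {e : ι → ℂ} {q : ι → Matrix (Fin n) (Fin n) ℂ} {m : ℕ}

theorem resolvent_apply (D : IsSpectralDecomposition B e q m) {z : ℂ} (hz : ∀ i, z ≠ e i)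
    (j l : Fin n) : (z • (1 : Matrix (Fin n) (Fin n) ℂ) - B)⁻¹ j l =
      ∑ i, ∑ k ∈ Finset.range m,
        ((B - algebraMap ℂ _ (e i)) ^ k * q i) j l / (z - e i) ^ (k + 1) := by
  rw [← Algebra.algebraMap_eq_smul_one,
    Matrix.inv_eq_right_inv (D.algebraMap_sub_mul_sum_eq_one hz)]
  simp only [Matrix.sum_apply, Matrix.smul_apply, smul_eq_mul, div_eq_inv_mul]

theorem circleIntegral_resolvent_apply (D : IsSpectralDecomposition B e q m) {ε : ℝ}
    (hε : IsAdmissibleRadius g B ε) {a : ℂ} (ha : a ∈ spectrum ℂ B) (j l : Fin n) :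
    (∮ z in C(a, ε), g z * (z • (1 : Matrix (Fin n) (Fin n) ℂ) - B)⁻¹ j l) =
      ∑ i, ∑ k ∈ Finset.range m, ((B - algebraMap ℂ _ (e i)) ^ k * q i) j l *
        ∮ z in C(a, ε), g z / (z - e i) ^ (k + 1) := by
  have hexpand : EqOn (fun z => g z * (z • (1 : Matrix (Fin n) (Fin n) ℂ) - B)⁻¹ j l)
      (fun z => ∑ i, ∑ k ∈ Finset.range m, ((B - algebraMap ℂ _ (e i)) ^ k * q i) j l *
        (g z / (z - e i) ^ (k + 1))) (Metric.sphere a ε) := fun z hz => by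
    simp only [D.resolvent_apply fun i => hε.ne_of_mem_sphere ha (D.mem_spectrum i) hz,
      Finset.mul_sum, mul_div_left_comm]
  have hint : ∀ i, ∀ k, CircleIntegrable (fun z =>
      ((B - algebraMap ℂ _ (e i)) ^ k * q i) j l * (g z / (z - e i) ^ (k + 1))) a ε := fun i k =>
    (hε.circleIntegrable_div_sub_pow ha (D.mem_spectrum i) (k + 1)).const_mul _
  rw [circleIntegral.integral_congr hε.1.le hexpand, circleIntegral.integral_fun_sum
    fun i _ => CircleIntegrable.fun_sum _ fun k _ => hint i k]
  simp only [circleIntegral.integral_fun_sum fun k _ => hint _ k,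
    circleIntegral.integral_const_mul]

theorem matrixFun_eq_sum (D : IsSpectralDecomposition B e q m)
    (hg : ∀ i, AnalyticAt ℂ g (e i)) :
    matrixFun g B =
      ∑ i, ∑ k ∈ Finset.range m, iteratedDeriv k g (e i) • jetCoeff B (e i) (q i) k := by
  obtain ⟨ε, hε⟩ := exists_isAdmissibleRadius (f := g) (A := B) fun a ha => by
    obtain ⟨i, rfl⟩ := D.exists_eq_of_mem_spectrum ha
    exact hg i
  rw [matrixFun_eq hε]
  ext j l
  simp only [matrixCauchyIntegral, Matrix.of_apply]
  rw [Finset.sum_congr rfl fun a ha => D.circleIntegral_resolvent_apply hε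
    ((Set.Finite.mem_toFinset _).1 ha) j l, Finset.sum_comm, Finset.mul_sum, Matrix.sum_apply]
  refine Finset.sum_congr rfl fun i _ => ?_
  rw [Finset.sum_comm, Finset.mul_sum, Matrix.sum_apply]
  refine Finset.sum_congr rfl fun k _ => ?_
  rw [← Finset.mul_sum, hε.sum_circleIntegral_div_sub_pow (D.mem_spectrum i)]
  rw [mul_left_comm, inv_mul_cancel_left₀ Complex.two_pi_I_ne_zero]
  simp only [jetCoeff, Matrix.smul_apply, smul_eq_mul]
  ring

theorem matrixFun_affine_eq_sum (D : IsSpectralDecomposition B e q m) {s t : ℂ}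
    (hg : ∀ i, AnalyticAt ℂ g (s + t * e i)) :
    matrixFun g (s • 1 + t • B) = ∑ i, ∑ k ∈ Finset.range m,
      (t ^ k • iteratedDeriv k g (s + t * e i)) • jetCoeff B (e i) (q i) k := by
  rw [(D.affine s t).matrixFun_eq_sum hg]
  refine Finset.sum_congr rfl fun i _ => Finset.sum_congr rfl fun k _ => ?_
  simp only [jetCoeff, affine_sub_algebraMap, smul_pow, smul_mul_assoc]
  module

end IsSpectralDecomposition

theorem matrixFun_congr (hf : ∀ a ∈ spectrum ℂ A, AnalyticAt ℂ f a)
    (hfg : ∀ a ∈ spectrum ℂ A, f =ᶠ[𝓝 a] g) : matrixFun f A = matrixFun g A := by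
  obtain ⟨S, m, q, D⟩ := exists_isSpectralDecomposition A
  rw [D.matrixFun_eq_sum fun i => hf i (D.mem_spectrum i),
    D.matrixFun_eq_sum fun i => (hf i (D.mem_spectrum i)).congr (hfg i (D.mem_spectrum i))]
  simp only [(hfg _ (D.mem_spectrum _)).iteratedDeriv_eq]

theorem matrixFun_add (hf : ∀ a ∈ spectrum ℂ A, AnalyticAt ℂ f a)
    (hg : ∀ a ∈ spectrum ℂ A, AnalyticAt ℂ g a) :
    matrixFun (f + g) A = matrixFun f A + matrixFun g A := by
  obtain ⟨S, m, q, D⟩ := exists_isSpectralDecomposition A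
  have hf' := fun i => hf _ (D.mem_spectrum i)
  have hg' := fun i => hg _ (D.mem_spectrum i)
  rw [D.matrixFun_eq_sum hf', D.matrixFun_eq_sum hg',
    D.matrixFun_eq_sum fun i => (hf' i).add (hg' i)]
  simp only [iteratedDeriv_add (hf' _).contDiffAt (hg' _).contDiffAt, add_smul,
    Finset.sum_add_distrib]

theorem matrixFun_const_mul (c : ℂ) (hg : ∀ a ∈ spectrum ℂ A, AnalyticAt ℂ g a) :
    matrixFun (fun w => c * g w) A = c • matrixFun g A := by
  obtain ⟨S, m, q, D⟩ := exists_isSpectralDecomposition A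
  have hg' := fun i => hg _ (D.mem_spectrum i)
  rw [D.matrixFun_eq_sum hg', D.matrixFun_eq_sum fun i => analyticAt_const.fun_mul (hg' i)]
  simp only [iteratedDeriv_const_mul_field, Finset.smul_sum, mul_smul]

theorem matrixFun_sub (hf : ∀ a ∈ spectrum ℂ A, AnalyticAt ℂ f a)
    (hg : ∀ a ∈ spectrum ℂ A, AnalyticAt ℂ g a) :
    matrixFun (f - g) A = matrixFun f A - matrixFun g A := by
  rw [eq_sub_iff_add_eq, ← matrixFun_add (fun a ha => (hf a ha).sub (hg a ha)) hg, sub_add_cancel]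

theorem mul_jetCoeff (B : Matrix (Fin n) (Fin n) ℂ) (c : ℂ) (q : Matrix (Fin n) (Fin n) ℂ)
    (k : ℕ) :
    B * jetCoeff B c q k = c • jetCoeff B c q k + (k + 1 : ℂ) • jetCoeff B c q (k + 1) := by
  have hfactorial : (k + 1 : ℂ) * ((k + 1).factorial : ℂ)⁻¹ = (k.factorial : ℂ)⁻¹ := by
    have hk : (k + 1 : ℂ) ≠ 0 := by exact_mod_cast k.succ_ne_zero
    rw [Nat.factorial_succ]
    push_cast
    field_simp
  calc B * jetCoeff B c q k
      = algebraMap ℂ _ c * jetCoeff B c q k + (B - algebraMap ℂ _ c) * jetCoeff B c q k := by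
        rw [← add_mul, add_sub_cancel]
    _ = c • jetCoeff B c q k + (k + 1 : ℂ) • jetCoeff B c q (k + 1) := by
        rw [← Algebra.smul_def]
        simp only [jetCoeff, mul_smul_comm, smul_smul (k + 1 : ℂ), hfactorial, ← mul_assoc,
          ← pow_succ']

theorem matrixFun_id_mul (hg : ∀ a ∈ spectrum ℂ A, AnalyticAt ℂ g a) :
    matrixFun (fun w => w * g w) A = A * matrixFun g A := by
  obtain ⟨S, m, q, D⟩ := exists_isSpectralDecomposition A
  have hg' := fun i => hg _ (D.mem_spectrum i)
  rw [D.matrixFun_eq_sum hg', D.matrixFun_eq_sum (g := fun w => w * g w) fun i =>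
    analyticAt_id.fun_mul (hg' i), Finset.mul_sum]
  refine Finset.sum_congr rfl fun i _ => ?_
  have hleibniz : ∀ k, iteratedDeriv k (fun w => w * g w) i =
      i * iteratedDeriv k g i + k * iteratedDeriv (k - 1) g i := fun k => by
    cases k with
    | zero => simp
    | succ k => simpa using iteratedDeriv_succ_sub_smul (a := 0) (hg' i) k
  let u : ℕ → Matrix (Fin n) (Fin n) ℂ := fun k =>
    (k * iteratedDeriv (k - 1) g i) • jetCoeff A i (q i) k
  have hshift : ∑ k ∈ Finset.range m, u k = ∑ k ∈ Finset.range m, u (k + 1) := by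
    have hzero : u 0 = 0 := by simp [u]
    have hlast : u m = 0 := by simp [u, jetCoeff, D.pow_mul_eq_zero]
    rw [← add_zero (∑ k ∈ Finset.range m, u k), ← hlast, ← Finset.sum_range_succ,
      Finset.sum_range_succ', hzero, add_zero]
  calc ∑ k ∈ Finset.range m, iteratedDeriv k (fun w => w * g w) i • jetCoeff A i (q i) k
      = ∑ k ∈ Finset.range m, (i * iteratedDeriv k g i) • jetCoeff A i (q i) k +
          ∑ k ∈ Finset.range m, u k := by
        simp only [hleibniz, add_smul, Finset.sum_add_distrib, u]
    _ = A * ∑ k ∈ Finset.range m, iteratedDeriv k g i • jetCoeff A i (q i) k := by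
        rw [hshift, ← Finset.sum_add_distrib, Finset.mul_sum]
        refine Finset.sum_congr rfl fun k _ => ?_
        rw [mul_smul_comm, mul_jetCoeff]
        simp only [u, Nat.add_sub_cancel, Nat.cast_add, Nat.cast_one]
        module

theorem matrixFun_pow_mul (hg : ∀ a ∈ spectrum ℂ A, AnalyticAt ℂ g a) (k : ℕ) :
    matrixFun (fun w => w ^ k * g w) A = A ^ k * matrixFun g A := by
  induction k with
  | zero => simp
  | succ k ih =>
    simp only [pow_succ', mul_assoc]
    rw [matrixFun_id_mul (g := fun w => w ^ k * g w) fun a ha =>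
      (analyticAt_id.pow k).fun_mul (hg a ha), ih]

theorem matrixFun_eval_mul (p : Polynomial ℂ) (hg : ∀ a ∈ spectrum ℂ A, AnalyticAt ℂ g a) :
    matrixFun (fun w => p.eval w * g w) A = Polynomial.aeval A p * matrixFun g A := by
  induction p using Polynomial.induction_on' with
  | add p₁ p₂ h₁ h₂ =>
    have hanalytic : ∀ p : Polynomial ℂ, ∀ a ∈ spectrum ℂ A,
        AnalyticAt ℂ (fun w => p.eval w * g w) a := fun p a ha =>
      (p.differentiable.analyticAt a).fun_mul (hg a ha)
    simp only [Polynomial.eval_add, add_mul, map_add, ← h₁, ← h₂]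
    exact matrixFun_add (hanalytic p₁) (hanalytic p₂)
  | monomial k c =>
    simp only [Polynomial.eval_monomial, Polynomial.aeval_monomial, mul_assoc]
    rw [matrixFun_const_mul (g := fun w => w ^ k * g w) c fun a ha =>
      (analyticAt_id.pow k).fun_mul (hg a ha), matrixFun_pow_mul hg, Algebra.smul_def]

theorem continuousOn_matrixFun_affine {T : Type*} [TopologicalSpace T] {s t : T → ℂ} {Y : Set T}
    (hs : ContinuousOn s Y) (ht : ContinuousOn t Y)
    (hg : ∀ p ∈ Y, ∀ a ∈ spectrum ℂ A, AnalyticAt ℂ g (s p + t p * a)) :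
    ContinuousOn (fun p => matrixFun g (s p • 1 + t p • A)) Y := by
  obtain ⟨S, m, q, D⟩ := exists_isSpectralDecomposition A
  have hsum : ContinuousOn (fun p => ∑ i : S, ∑ k ∈ Finset.range m,
      (t p ^ k • iteratedDeriv k g (s p + t p * i)) • jetCoeff A i (q i) k) Y := by
    refine continuousOn_finsetSum _ fun i _ => continuousOn_finsetSum _ fun k _ p hp => ?_
    have hjet : ContinuousWithinAt (fun p => iteratedDeriv k g (s p + t p * i)) Y p :=
      (analyticAt_iteratedDeriv (hg p hp i (D.mem_spectrum i)) k).continuousAt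
        |>.comp_continuousWithinAt (f := fun p => s p + t p * i)
          ((hs p hp).add ((ht p hp).mul_const _))
    exact (((ht p hp).pow k).smul hjet).smul continuousWithinAt_const
  exact hsum.congr fun p hp => D.matrixFun_affine_eq_sum fun i => hg p hp i (D.mem_spectrum i)

end FunctionalCalculus

section HermiteGenocchi

variable {F : Type*} [NormedAddCommGroup F] [NormedSpace ℂ F] {n : ℕ}
  {A : Matrix (Fin n) (Fin n) ℂ} {L : Matrix (Fin n) (Fin n) ℂ →ₗ[ℂ] F} {h : ℂ → ℂ}

theorem IsSpectralDecomposition.map_pow_smul_matrixFun_iteratedDeriv {ι : Type*} [Fintype ι]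
    {e : ι → ℂ} {q : ι → Matrix (Fin n) (Fin n) ℂ} {m : ℕ} (D : IsSpectralDecomposition A e q m)
    (L : Matrix (Fin n) (Fin n) ℂ →ₗ[ℂ] F) {s t : ℂ} (hh : ∀ i, AnalyticAt ℂ h (s + t * e i))
    (N j : ℕ) :
    t ^ j • L (matrixFun (iteratedDeriv N h) (s • 1 + t • A)) = ∑ i, ∑ k ∈ Finset.range m,
      (t ^ (j + k) • iteratedDeriv (N + k) h (s + t * e i)) • L (jetCoeff A (e i) (q i) k) := by
  rw [D.matrixFun_affine_eq_sum fun i => analyticAt_iteratedDeriv (hh i) N]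
  simp only [map_sum, map_smul, Finset.smul_sum, iteratedDeriv_iteratedDeriv, pow_add,
    mul_smul, smul_assoc]

theorem hasDerivAt_pow_smul_matrixFun_dslope {a t : ℂ} (ha : AnalyticAt ℂ h a)
    (hA : ∀ x ∈ spectrum ℂ A, AnalyticAt ℂ h ((1 - t) * a + t * x))
    (L : Matrix (Fin n) (Fin n) ℂ →ₗ[ℂ] F) (N : ℕ) :
    HasDerivAt (fun r => r ^ (N + 1) •
        L (matrixFun (iteratedDeriv N (dslope h a)) (((1 - r) * a) • 1 + r • A)))
      (t ^ N • L (matrixFun (iteratedDeriv (N + 1) h) (((1 - t) * a) • 1 + t • A))) t := by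
  obtain ⟨S, m, q, D⟩ := exists_isSpectralDecomposition A
  have hanalytic : ∀ᶠ r in 𝓝 t, ∀ i : S, AnalyticAt ℂ h ((1 - r) * a + r * i) := by
    refine eventually_all.2 fun i => ?_
    have hline : ContinuousAt (fun r : ℂ => (1 - r) * a + r * i) t := by fun_prop
    exact hline.eventually (hA i (D.mem_spectrum i)).eventually_analyticAt
  have hsum : HasDerivAt (fun r => ∑ i : S, ∑ k ∈ Finset.range m,
      (r ^ (N + 1 + k) • iteratedDeriv (N + k) (dslope h a) ((1 - r) * a + r * i)) •
        L (jetCoeff A i (q i) k))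
      (∑ i : S, ∑ k ∈ Finset.range m, (t ^ (N + k) •
        iteratedDeriv (N + 1 + k) h ((1 - t) * a + t * i)) • L (jetCoeff A i (q i) k)) t := by
    refine HasDerivAt.fun_sum fun i _ => HasDerivAt.fun_sum fun k _ => ?_
    rw [add_right_comm N 1 k]
    exact (hasDerivAt_pow_smul_iteratedDeriv_dslope ha (hanalytic.self_of_nhds i)
      (N + k)).smul_const _
  rw [D.map_pow_smul_matrixFun_iteratedDeriv L hanalytic.self_of_nhds]
  refine hsum.congr_of_eventuallyEq (hanalytic.mono fun r hr => ?_)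
  exact D.map_pow_smul_matrixFun_iteratedDeriv L (fun i => analyticAt_dslope ha (hr i)) N (N + 1)

theorem one_sub_mul_add_mul_mem {X : Set ℂ} (hX : Convex ℝ X) {a x : ℂ} (ha : a ∈ X) (hx : x ∈ X)
    {t : ℝ} (ht : t ∈ Icc (0 : ℝ) 1) : (1 - (t : ℂ)) * a + t * x ∈ X := by
  simpa using hX ha hx (sub_nonneg.2 ht.2) ht.1 (sub_add_cancel 1 t)

theorem norm_matrixFun_iteratedDeriv_dslope_le {X : Set ℂ} (hX : Convex ℝ X)
    (hA : spectrum ℂ A ⊆ X) (hh : AnalyticOnNhd ℂ h X) {a : ℂ} (ha : a ∈ X) {N : ℕ} {M : ℝ}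
    (hM : ∀ t ∈ Icc (0 : ℝ) 1, ‖L (matrixFun (iteratedDeriv (N + 1) h)
      (((1 - (t : ℂ)) * a) • 1 + (t : ℂ) • A))‖ ≤ M) :
    ‖L (matrixFun (iteratedDeriv N (dslope h a)) A)‖ ≤ M / (N + 1) := by
  have hanalytic : ∀ t ∈ Icc (0 : ℝ) 1, ∀ x ∈ spectrum ℂ A,
      AnalyticAt ℂ h ((1 - (t : ℂ)) * a + t * x) := fun t ht x hx =>
    hh _ (one_sub_mul_add_mul_mem hX ha (hA hx) ht)
  have hderiv : ∀ t ∈ Icc (0 : ℝ) 1, HasDerivAt (fun r : ℝ => (r : ℂ) ^ (N + 1) •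
      L (matrixFun (iteratedDeriv N (dslope h a)) (((1 - (r : ℂ)) * a) • 1 + (r : ℂ) • A)))
      ((t : ℂ) ^ N • L (matrixFun (iteratedDeriv (N + 1) h)
        (((1 - (t : ℂ)) * a) • 1 + (t : ℂ) • A))) t := fun t ht => by
    simpa [Function.comp_def] using
      (hasDerivAt_pow_smul_matrixFun_dslope (hh a ha) (hanalytic t ht) L N).scomp t
        Complex.ofRealCLM.hasDerivAt
  have hbound : ∀ t : ℝ, HasDerivAt (fun r => M * r ^ (N + 1) / (N + 1)) (M * t ^ N) t := by
    intro t
    convert! ((hasDerivAt_pow (N + 1) t).const_mul M).div_const (N + 1 : ℝ) using 1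
    push_cast
    field_simp
  have hle := image_norm_le_of_norm_deriv_right_le_deriv_boundary
    (fun t ht => (hderiv t ht).continuousAt.continuousWithinAt)
    (fun t ht => (hderiv t (Ico_subset_Icc_self ht)).hasDerivWithinAt) (by simp) hbound
    (fun t ht => ?_) (right_mem_Icc.2 zero_le_one)
  · simpa using hle
  · rw [norm_smul, norm_pow, Complex.norm_real, Real.norm_of_nonneg ht.1, mul_comm]
    exact mul_le_mul_of_nonneg_right (hM t (Ico_subset_Icc_self ht)) (pow_nonneg ht.1 N)

theorem norm_matrixFun_dividedDiff_le {X C : Set ℂ} (hX : Convex ℝ X) (hC : Convex ℝ C)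
    (hCX : C ⊆ X) (hCne : C.Nonempty) (hA : spectrum ℂ A ⊆ X) (hh : AnalyticOnNhd ℂ h X)
    {l : List ℂ} (hl : ∀ a ∈ l, a ∈ C) {M : ℝ}
    (hM : ∀ t ∈ Icc (0 : ℝ) 1, ∀ μ ∈ C, ‖L (matrixFun (iteratedDeriv l.length h)
      (((1 - (t : ℂ)) * μ) • 1 + (t : ℂ) • A))‖ ≤ M) :
    ‖L (matrixFun (dividedDiff l h) A)‖ ≤ M / l.length.factorial := by
  induction l generalizing h M with
  | nil =>
    obtain ⟨μ, hμ⟩ := hCne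
    simpa using hM 1 (right_mem_Icc.2 zero_le_one) μ hμ
  | cons a l ih =>
    have ha : a ∈ C := hl a List.mem_cons_self
    have hdslope : AnalyticOnNhd ℂ (dslope h a) X := fun x hx =>
      analyticAt_dslope (hh a (hCX ha)) (hh x hx)
    rw [List.length_cons, Nat.factorial_succ, Nat.cast_mul, ← div_div, Nat.cast_succ]
    refine ih hdslope (fun b hb => hl b (List.mem_cons_of_mem a hb)) fun t ht μ hμ => ?_
    refine norm_matrixFun_iteratedDeriv_dslope_le hX ?_ hh (hCX ha) fun τ hτ => ?_
    · intro x hx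
      obtain ⟨y, hy, rfl⟩ := exists_eq_of_mem_spectrum_affine hx
      exact one_sub_mul_add_mul_mem hX (hCX hμ) (hA hy) ht
    · obtain ⟨ν, hν, hcombo⟩ := hC.exists_mem_add_smul_eq ha hμ (sub_nonneg.2 hτ.2)
        (mul_nonneg hτ.1 (sub_nonneg.2 ht.2))
      have hcoeff : (1 - (τ : ℂ)) * a + τ * ((1 - t) * μ) = (1 - ((τ * t : ℝ) : ℂ)) * ν := by
        rw [show 1 - τ + τ * (1 - t) = 1 - τ * t by ring] at hcombo
        simpa [mul_assoc] using hcombo.symm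
      have hcomp : ((1 - (τ : ℂ)) * a) • (1 : Matrix (Fin n) (Fin n) ℂ) +
          (τ : ℂ) • (((1 - (t : ℂ)) * μ) • 1 + (t : ℂ) • A) =
          ((1 - ((τ * t : ℝ) : ℂ)) * ν) • 1 + ((τ * t : ℝ) : ℂ) • A := by
        rw [← hcoeff]
        push_cast
        module
      rw [hcomp]
      exact hM (τ * t) ⟨mul_nonneg hτ.1 ht.1, mul_le_one₀ hτ.2 ht.1 ht.2⟩ ν hν

end HermiteGenocchi

section InterpolationError

variable {n N : ℕ} {A : Matrix (Fin n) (Fin n) ℂ} {z : Fin N → ℂ} {f : ℂ → ℂ}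
  {u v : Polynomial ℂ}

theorem count_ofFn_eq_card_filter {α : Type*} [DecidableEq α] (z : Fin N → α) (x : α) :
    (List.ofFn z).count x = (Finset.univ.filter fun i => z i = x).card := by
  simpa using (Fin.card_filter_univ_eq_vector_get_eq_count x (List.Vector.ofFn z)).symm

theorem eval_nodalPoly (z : Fin N → ℂ) (w : ℂ) :
    (nodalPoly z).eval w = ((List.ofFn z).map (w - ·)).prod := by
  simp [nodalPoly, Polynomial.eval_prod, List.map_ofFn, List.prod_ofFn]

theorem analyticAt_eval_div_eval {w : ℂ} (hv : v.eval w ≠ 0) :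
    AnalyticAt ℂ (fun w => u.eval w / v.eval w) w :=
  (u.differentiable.analyticAt w).fun_div (v.differentiable.analyticAt w) hv

theorem eval_mul_sub_div_eventuallyEq {w : ℂ} (hv : v.eval w ≠ 0) :
    (fun w => v.eval w * (f - fun w => u.eval w / v.eval w) w) =ᶠ[𝓝 w]
      fun w => v.eval w * f w - u.eval w := by
  filter_upwards [v.continuous.continuousAt.eventually_ne hv] with w hw
  rw [Pi.sub_apply, mul_sub, mul_div_cancel₀ _ hw]

theorem Interpolates.count_le_analyticOrderAt (hint : Interpolates u v f z) {k : Fin N}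
    (hf : AnalyticAt ℂ f (z k)) (hv : v.eval (z k) ≠ 0) :
    ((List.ofFn z).count (z k) : ℕ∞) ≤
      analyticOrderAt (fun w => v.eval w * f w - u.eval w) (z k) := by
  have hr := analyticAt_eval_div_eval (u := u) hv
  rw [← analyticOrderAt_congr (eval_mul_sub_div_eventuallyEq hv)]
  refine le_trans ?_ (le_add_self.trans_eq
    (analyticOrderAt_mul (v.differentiable.analyticAt (z k)) (hf.sub hr)).symm)
  rw [natCast_le_analyticOrderAt_iff_iteratedDeriv_eq_zero (hf.sub hr)]
  intro j hj
  rw [count_ofFn_eq_card_filter] at hj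
  rw [iteratedDeriv_sub hf.contDiffAt hr.contDiffAt, hint k j hj, sub_self]

theorem Interpolates.eval_mul_sub_eval_eq (hint : Interpolates u v f z) (hu : u.degree < N)
    (hf : ∀ k, AnalyticAt ℂ f (z k)) (hv : ∀ k, v.eval (z k) ≠ 0) (w : ℂ) :
    v.eval w * f w - u.eval w =
      (nodalPoly z).eval w * dividedDiff (List.ofFn z) (fun w => v.eval w * f w) w := by
  rw [eval_nodalPoly]
  refine sub_polynomial_eval_eq_prod_mul_dividedDiff (h := fun w => v.eval w * f w)
    (by simpa using hu) (List.forall_mem_ofFn_iff.2 fun k => ?_)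
    (List.forall_mem_ofFn_iff.2 fun k => hint.count_le_analyticOrderAt (hf k) (hv k)) w
  exact (v.differentiable.analyticAt _).fun_mul (hf k)

theorem isUnit_aeval_of_eval_ne_zero {K R : Type*} [Field K] [IsAlgClosed K] [Ring R]
    [Algebra K R] [FiniteDimensional K R] {b : R} {p : Polynomial K}
    (hp : ∀ a ∈ spectrum K b, p.eval a ≠ 0) : IsUnit (Polynomial.aeval b p) := by
  obtain hsubsingleton | hnontrivial := subsingleton_or_nontrivial R
  · exact isUnit_of_subsingleton _
  · rw [← spectrum.zero_notMem_iff K, spectrum.map_polynomial_aeval_of_nonempty b p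
      (spectrum.nonempty_of_isAlgClosed_of_finiteDimensional K b)]
    rintro ⟨a, ha, hzero⟩
    exact hp a ha hzero

theorem commute_aeval_inv_aeval {R m : Type*} [CommRing R] [Fintype m] [DecidableEq m]
    {B : Matrix m m R} (p : Polynomial R) {q : Polynomial R}
    (hq : IsUnit (Polynomial.aeval B q)) :
    Commute (Polynomial.aeval B p) (Polynomial.aeval B q)⁻¹ := by
  obtain ⟨Q, hQ⟩ := hq
  rw [← hQ, ← Matrix.coe_units_inv]
  exact Commute.units_inv_right (hQ ▸ (Commute.all p q).map (Polynomial.aeval B))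

theorem Interpolates.matrixFun_sub_matrixFun_eq (hint : Interpolates u v f z)
    (hu : u.degree < N) (hfA : ∀ a ∈ spectrum ℂ A, AnalyticAt ℂ f a)
    (hfz : ∀ k, AnalyticAt ℂ f (z k)) (hvz : ∀ k, v.eval (z k) ≠ 0)
    (hvA : ∀ a ∈ spectrum ℂ A, v.eval a ≠ 0) :
    matrixFun f A - matrixFun (fun w => u.eval w / v.eval w) A =
      Polynomial.aeval A (nodalPoly z) * (Polynomial.aeval A v)⁻¹ *
        matrixFun (dividedDiff (List.ofFn z) fun w => v.eval w * f w) A := by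
  have hv := fun w => v.differentiable.analyticAt w
  have hr : ∀ a ∈ spectrum ℂ A, AnalyticAt ℂ (fun w => u.eval w / v.eval w) a := fun a ha =>
    analyticAt_eval_div_eval (hvA a ha)
  have hd : ∀ a ∈ spectrum ℂ A,
      AnalyticAt ℂ (dividedDiff (List.ofFn z) fun w => v.eval w * f w) a := fun a ha =>
    analyticAt_dividedDiff (List.forall_mem_ofFn_iff.2 fun k => (hv _).fun_mul (hfz k))
      ((hv a).fun_mul (hfA a ha))
  have hfr : ∀ a ∈ spectrum ℂ A, AnalyticAt ℂ (f - fun w => u.eval w / v.eval w) a :=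
    fun a ha => (hfA a ha).sub (hr a ha)
  have hmul : Polynomial.aeval A v * matrixFun (f - fun w => u.eval w / v.eval w) A =
      Polynomial.aeval A (nodalPoly z) *
        matrixFun (dividedDiff (List.ofFn z) fun w => v.eval w * f w) A := by
    rw [← matrixFun_eval_mul v hfr, ← matrixFun_eval_mul _ hd]
    refine matrixFun_congr (fun a ha => (hv a).fun_mul (hfr a ha)) fun a ha => ?_
    simpa only [hint.eval_mul_sub_eval_eq hu hfz hvz] using
      eval_mul_sub_div_eventuallyEq (f := f) (u := u) (hvA a ha)
  have hunit := isUnit_aeval_of_eval_ne_zero hvA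
  rw [← matrixFun_sub hfA hr, (commute_aeval_inv_aeval _ hunit).eq, mul_assoc, ← hmul,
    ← mul_assoc, Matrix.nonsing_inv_mul _ ((Matrix.isUnit_iff_isUnit_det _).1 hunit), one_mul]

end InterpolationError

theorem exists_isGreatest_norm_matrixFun_affine {n : ℕ} {F : Type*} [NormedAddCommGroup F]
    [NormedSpace ℂ F] {A : Matrix (Fin n) (Fin n) ℂ} {X C : Set ℂ} (hX : Convex ℝ X)
    (hC : IsCompact C) (hCX : C ⊆ X) (hCne : C.Nonempty) (hA : spectrum ℂ A ⊆ X) {g : ℂ → ℂ}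
    (hg : AnalyticOnNhd ℂ g X) (L : Matrix (Fin n) (Fin n) ℂ →ₗ[ℂ] F) :
    ∃ M : ℝ, IsGreatest {x : ℝ | ∃ t ∈ Icc (0 : ℝ) 1, ∃ μ ∈ C,
      x = ‖L (matrixFun g (((1 - (t : ℂ)) * μ) • 1 + (t : ℂ) • A))‖} M := by
  have hmatrix : ContinuousOn (fun p : ℝ × ℂ =>
      matrixFun g (((1 - (p.1 : ℂ)) * p.2) • 1 + (p.1 : ℂ) • A)) (Icc (0 : ℝ) 1 ×ˢ C) :=
    continuousOn_matrixFun_affine (by fun_prop) (by fun_prop) fun p hp a ha =>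
      hg _ (one_sub_mul_add_mul_mem hX (hCX hp.2) (hA ha) hp.1)
  have hL : Continuous L := L.continuous_of_finiteDimensional
  obtain ⟨p, hp, hmax⟩ := (isCompact_Icc.prod hC).exists_isMaxOn
    ((nonempty_Icc.2 zero_le_one).prod hCne) (hL.comp_continuousOn hmatrix).norm
  refine ⟨‖L (matrixFun g (((1 - (p.1 : ℂ)) * p.2) • 1 + (p.1 : ℂ) • A))‖,
    ⟨p.1, hp.1, p.2, hp.2, rfl⟩, ?_⟩
  rintro x ⟨s, hs, ν, hν, hx⟩
  rw [hx]
  exact isMaxOn_iff.1 hmax (s, ν) (mk_mem_prod hs hν)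

theorem corollaryc_general {n N : ℕ} {F : Type*} [NormedAddCommGroup F] [NormedSpace ℂ F]
    (hN : 0 < N) (A : Matrix (Fin n) (Fin n) ℂ) (z : Fin N → ℂ) (f : ℂ → ℂ)
    (hf : AnalyticOnNhd ℂ f (convexHull ℝ (spectrum ℂ A ∪ range z)))
    (u v : Polynomial ℂ) (hu : u.degree < N)
    (hvz : ∀ k, v.eval (z k) ≠ 0) (hvA : ∀ a ∈ spectrum ℂ A, v.eval a ≠ 0)
    (hint : Interpolates u v f z) (L : Matrix (Fin n) (Fin n) ℂ →ₗ[ℂ] F) :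
    ∃ M : ℝ,
      IsGreatest
        {x : ℝ | ∃ t ∈ Icc (0 : ℝ) 1, ∃ μ ∈ convexHull ℝ (range z),
          x = ‖L (Polynomial.aeval A (nodalPoly z) * (Polynomial.aeval A v)⁻¹ *
            ((N.factorial : ℂ)⁻¹ • matrixFun (iteratedDeriv N (fun w => v.eval w * f w))
              (((1 - (t : ℂ)) * μ) • (1 : Matrix (Fin n) (Fin n) ℂ) + (t : ℂ) • A)))‖} M ∧
      ‖L (matrixFun f A - matrixFun (fun w => u.eval w / v.eval w) A)‖ ≤ M := by
  obtain ⟨hAX, hzX⟩ := union_subset_iff.1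
    (subset_convexHull ℝ (spectrum ℂ A ∪ range z))
  have hX := convex_convexHull ℝ (spectrum ℂ A ∪ range z)
  have hCX : convexHull ℝ (range z) ⊆ convexHull ℝ (spectrum ℂ A ∪ range z) :=
    convexHull_mono subset_union_right
  have hCne : (convexHull ℝ (range z)).Nonempty := ⟨z ⟨0, hN⟩, subset_convexHull ℝ _ ⟨_, rfl⟩⟩
  have hvf : AnalyticOnNhd ℂ (fun w => v.eval w * f w)
      (convexHull ℝ (spectrum ℂ A ∪ range z)) := fun x hx =>
    (v.differentiable.analyticAt x).fun_mul (hf x hx)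
  let P := L ∘ₗ LinearMap.mulLeft ℂ
    (Polynomial.aeval A (nodalPoly z) * (Polynomial.aeval A v)⁻¹)
  obtain ⟨M, hM⟩ := exists_isGreatest_norm_matrixFun_affine hX
    ((finite_range z).isCompact_convexHull ℝ) hCX hCne hAX
    (fun x hx => analyticAt_iteratedDeriv (hvf x hx) N)
    (P ∘ₗ ((N.factorial : ℂ)⁻¹ • LinearMap.id))
  refine ⟨M, hM, ?_⟩
  rw [hint.matrixFun_sub_matrixFun_eq hu (fun a ha => hf a (hAX ha))
    (fun k => hf _ (hzX ⟨k, rfl⟩)) hvz hvA]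
  have hfactorial : (0 : ℝ) < N.factorial := by positivity
  have hbound := norm_matrixFun_dividedDiff_le (L := P) (l := List.ofFn z)
    (M := M * N.factorial) hX (convex_convexHull ℝ (range z)) hCX hCne hAX hvf
    (List.forall_mem_ofFn_iff.2 fun k => subset_convexHull ℝ _ ⟨k, rfl⟩) fun t ht μ hμ => by
      have hle := hM.2 ⟨t, ht, μ, hμ, rfl⟩
      simpa [norm_smul, inv_mul_le_iff₀' hfactorial] using hle
  simpa [P, mul_assoc, hfactorial.ne'] using hbound

theorem corollaryc {n N : ℕ} (hN : 0 < N) (A : Matrix (Fin n) (Fin n) ℂ) (z : Fin N → ℂ)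
    (f : ℂ → ℂ) (U : Set ℂ) (hU : IsOpen U)
    (hsub : convexHull ℝ (spectrum ℂ A ∪ Set.range z) ⊆ U) (hf : AnalyticOnNhd ℂ f U)
    (u v : Polynomial ℂ) (hu : u.natDegree ≤ N - 1)
    (hvz : ∀ k, v.eval (z k) ≠ 0) (hvA : ∀ a ∈ spectrum ℂ A, v.eval a ≠ 0)
    (hint : Interpolates u v f z) (b : Fin n → ℂ) :
    ∃ M : ℝ,
      IsGreatest
        {x : ℝ | ∃ t ∈ Set.Icc (0 : ℝ) 1, ∃ μ ∈ convexHull ℝ (Set.range z),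
          x = euclNorm
            ((Polynomial.aeval A (nodalPoly z) * (Polynomial.aeval A v)⁻¹ *
              ((Nat.factorial N : ℂ)⁻¹ •
                matrixFun (iteratedDeriv N (fun w => v.eval w * f w))
                  (((1 - (t : ℂ)) * μ) • (1 : Matrix (Fin n) (Fin n) ℂ) + (t : ℂ) • A))).mulVec
              b)} M ∧
      euclNorm ((matrixFun f A - matrixFun (fun w => u.eval w / v.eval w) A).mulVec b) ≤ M := by
  exact corollaryc_general hN A z f (hf.mono hsub) u v
    ((Polynomial.degree_le_of_natDegree_le hu).trans_lt (by exact_mod_cast Nat.sub_lt hN one_pos))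
    hvz hvA hint ((WithLp.linearEquiv 2 ℂ (Fin n → ℂ)).symm.toLinearMap ∘ₗ
      (Matrix.mulVecBilin ℂ ℂ).flip b)
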